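/- Let $n\ge 1$ and let $G=([n],E)$ be a directed graph without loops or multiple edges, with $m=|E|$ edges, that is strongly connected. Let $K=\mathbb R$ or $K=\mathbb C$. Let $A(G)$ be the symbolic $n\times n$ matrix whose entry at position $(k,l)$ is an indeterminate $a_{kl}$ if $k=l$ or $l\to k$ is an edge of $G$, and $0$ otherwise, and let $\Theta_G\subseteq K^{n\times n}$ be the linear space of all matrices that vanish at the off-diagonal positions $(k,l)$ for which $l\to k$ is not an edge. For a matrix $A$ let $A_1$ be obtained by deleting its first row and column, and let $c:\Theta_G\to K^{2n-1}$ send $A$ to the tuple of all non-leading coefficients of the characteristic polynomials of $A$ and of $A_1$. Say that $G$ has the expected dimension (over $K$) if the image of $c$ has dimension $m+1$, the dimension of a set being the Krull dimension of the coordinate ring of its Zariski closure. For $A\in\Theta_G$ write $[X,A]=XA-AX$, $Z(A)=\{X\in K^{n\times n}: [X,A]=0\}$, $\mathcal D_n$ for the space of diagonal $n\times n$ matrices, and $$V_A=\{X\in K^{n\times n} : [X,A]\in\ker(d_Ac)\},\qquad \ker(d_Ac)\subseteq\Theta_G .$$ Let $i,j\in\{2,\dots,n\}$ with $i\ne j$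 be such that in $A(G)$ the support of row $j$ is contained in the support of row $i$, and the support of column $i$ is contained in the support of column $j$. Let $E_{ij}$ be the matrix with a $1$ at position $(i,j)$ and zeros elsewhere. Then: 1. for every $A\in\Theta_G$, $Z(A)+\mathcal D_n\subseteq V_A$ and $E_{ij}\in V_A$; 2. for sufficiently general $A\in\Theta_G$ (that is, for all $A$ in some nonempty Zariski-open subset of $\Theta_G$) the class of $E_{ij}$ in $V_A/(Z(A)+\mathcal D_n)$ is nonzero; 3. $G$ does not have the expected dimension. -/

import Mathlib

/-!
Linear compartment models with `n + 1` compartments, labelled by `Fin (n + 1)`; the input-output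
compartment, called compartment 1 in English, is `0 : Fin (n + 1)`. A directed graph on the
compartments is a `Digraph (Fin (n + 1))`, where `G.Adj k l` means that there is an edge `k → l`.
-/

noncomputable section

namespace Compartment

/-- Every vertex can be reached from every vertex along a directed path. -/
def StronglyConnected {V : Type*} (G : Digraph V) : Prop :=
  ∀ u v : V, Relation.ReflTransGen G.Adj u v

/-- The number `m` of edges. -/
def numEdges {V : Type*} (G : Digraph V) : ℕ :=
  {e : V × V | G.Adj e.1 e.2}.ncard

open Classical in
/-- The symbolic parameter matrix `A(G)`: position `(k, l)` carries the indeterminate `a_{kl}` if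
`k = l` or if `l → k` is an edge, and `0` otherwise. -/
def symbolicMatrix {V : Type*} (𝕜 : Type*) [Field 𝕜] (G : Digraph V) :
    Matrix V V (MvPolynomial (V × V) 𝕜) :=
  Matrix.of fun k l => if k = l ∨ G.Adj l k then MvPolynomial.X (k, l) else 0

/-- The support condition on the pair `(i, j)`, without the requirements `i, j ≠ 1` and `i ≠ j`:
the support of row `j` is contained in that of row `i`, and the support of column `i` is contained
in that of column `j`. -/
def SupportCondition {V R : Type*} [Zero R] (M : Matrix V V R) (i j : V) : Prop :=
  Function.support (M.row j) ⊆ Function.support (M.row i) ∧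
    Function.support (M.col i) ⊆ Function.support (M.col j)

/-- The parameter space `Θ_G`: all matrices vanishing at the off-diagonal positions `(k, l)` for
which `l → k` is not an edge. -/
def paramSpace {V : Type*} (𝕜 : Type*) [Field 𝕜] (G : Digraph V) :
    Submodule 𝕜 (Matrix V V 𝕜) where
  carrier := {A | ∀ k l, k ≠ l → ¬ G.Adj l k → A k l = 0}
  zero_mem' := fun _ _ _ _ => rfl
  add_mem' := fun ha hb k l h h' => by
    rw [Matrix.add_apply, ha k l h h', hb k l h h', add_zero]
  smul_mem' := fun c _ ha k l h h' => by
    rw [Matrix.smul_apply, ha k l h h', smul_zero]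

/-- `P A` holds for sufficiently general `A ∈ Θ_G`: it holds on a nonempty Zariski-open subset,
namely outside the zero set of some polynomial that does not vanish identically on `Θ_G`. -/
def ForGeneral {V : Type*} {𝕜 : Type*} [Field 𝕜] (G : Digraph V)
    (P : paramSpace 𝕜 G → Prop) : Prop :=
  ∃ p : MvPolynomial (V × V) 𝕜,
    (∃ A : paramSpace 𝕜 G, MvPolynomial.eval (fun e => A.1 e.1 e.2) p ≠ 0) ∧
    ∀ A : paramSpace 𝕜 G, MvPolynomial.eval (fun e => A.1 e.1 e.2) p ≠ 0 → P A

/-- `A₁`: the matrix `A` with its first row and column deleted. -/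
def deleteFirst {n : ℕ} {R : Type*} (A : Matrix (Fin (n + 1)) (Fin (n + 1)) R) :
    Matrix (Fin n) (Fin n) R :=
  A.submatrix Fin.succ Fin.succ

/-- The double characteristic polynomial map `c : Θ_G → 𝕜^(2 (n + 1) - 1)`, sending `A` to all
coefficients, except the leading ones, of the characteristic polynomials of `A` and of `A₁`
(in order of decreasing degree). -/
def doubleCharpoly {n : ℕ} (𝕜 : Type*) [Field 𝕜] (G : Digraph (Fin (n + 1)))
    (A : paramSpace 𝕜 G) : Fin (n + 1) ⊕ Fin n → 𝕜 :=
  Sum.elim (fun k => A.1.charpoly.coeff (k.rev : ℕ))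
    (fun k => (deleteFirst A.1).charpoly.coeff (k.rev : ℕ))

/-- The dimension of a subset of affine space: the Krull dimension of the coordinate ring of its
Zariski closure. -/
def zariskiDim {σ 𝕜 : Type*} [Field 𝕜] (S : Set (σ → 𝕜)) : WithBot ℕ∞ :=
  ringKrullDim (MvPolynomial σ 𝕜 ⧸ MvPolynomial.vanishingIdeal 𝕜 S)

/-- `G` has the expected dimension: the image of the double characteristic polynomial map has
dimension `m + 1`. -/
def HasExpectedDimension {n : ℕ} (𝕜 : Type*) [Field 𝕜] (G : Digraph (Fin (n + 1))) : Prop :=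
  zariskiDim (Set.range (doubleCharpoly 𝕜 G)) = ((numEdges G + 1 : ℕ) : WithBot ℕ∞)

/-- The commutator map `X ↦ [X, A] = X A - A X`. -/
def commutatorMap {V 𝕜 : Type*} [Fintype V] [Field 𝕜] (A : Matrix V V 𝕜) :
    Matrix V V 𝕜 →ₗ[𝕜] Matrix V V 𝕜 :=
  LinearMap.mulRight 𝕜 A - LinearMap.mulLeft 𝕜 A

/-- The centralizer `Z(A) = {X | [X, A] = 0}` in the space of all matrices. -/
def centralizer {V 𝕜 : Type*} [Fintype V] [Field 𝕜] (A : Matrix V V 𝕜) :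
    Submodule 𝕜 (Matrix V V 𝕜) :=
  LinearMap.ker (commutatorMap A)

/-- The space of diagonal matrices. -/
def diagonalMatrices (V 𝕜 : Type*) [DecidableEq V] [Field 𝕜] : Submodule 𝕜 (Matrix V V 𝕜) :=
  LinearMap.range (Matrix.diagonalLinearMap V 𝕜 𝕜)

/-- The kernel of the differential `d_A c : Θ_G → 𝕜^(2 (n + 1) - 1)`, a subspace of `Θ_G`
(which carries the subspace topology of the finite-dimensional space of all matrices). -/
def kerDifferential {n : ℕ} {𝕜 : Type*} [RCLike 𝕜] (G : Digraph (Fin (n + 1)))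
    (A : paramSpace 𝕜 G) : Submodule 𝕜 (paramSpace 𝕜 G) :=
  LinearMap.ker (fderiv 𝕜 (doubleCharpoly 𝕜 G) A).toLinearMap

/-- `V_A = {X | [X, A] ∈ ker (d_A c)}`, where membership includes `[X, A] ∈ Θ_G`. -/
def preimageSpace {n : ℕ} {𝕜 : Type*} [RCLike 𝕜] (G : Digraph (Fin (n + 1)))
    (A : paramSpace 𝕜 G) : Submodule 𝕜 (Matrix (Fin (n + 1)) (Fin (n + 1)) 𝕜) :=
  ((kerDifferential G A).map (paramSpace 𝕜 G).subtype).comap (commutatorMap A.1)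

/-- The subspace `Z(A) + D` of the space of all matrices, with `D` the diagonal matrices. -/
def trivialSpace {V 𝕜 : Type*} [Fintype V] [DecidableEq V] [Field 𝕜] (A : Matrix V V 𝕜) :
    Submodule 𝕜 (Matrix V V 𝕜) :=
  centralizer A ⊔ diagonalMatrices V 𝕜

end Compartment

end

namespace Compartment

/-! Conjugation by an invertible matrix that is block diagonal with respect to index `0` preserves
both characteristic polynomials. Infinitesimally, `[X, A]` is killed by the differential for every
block `X`, provided it lies in `Θ_G`. Diagonal matrices qualify, and so does `E_ij`, since `i, j ≠
0` and the support condition says exactly that `[E_ij, A]` stays in `Θ_G`. If `E_ij = Z + D` with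
`Z` centralizing `A`, then `[D, A] = [E_ij, A]` vanishes off row `i` and column `j`. A path from `i`
to `j` then forces `d i = d j`, and entry `(i, j)` gives `A i i = A j j`, which fails generically
(`single_notMem_trivialSpace`). The dimension bound uses a normal form instead of tangent spaces.
Conjugating by `1 + t E_ij` clears one entry, and a diagonal conjugation sets the `n` entries of a
spanning tree to one. Of the `m + n + 1` parameters `m` remain, so the image has dimension at most
`m` (`zariskiDim_range_doubleCharpoly_le`). -/

/-! ### Dimension of the closure of a polynomial image. -/

theorem ringKrullDim_le_of_isIntegral {R S : Type*} [CommRing R] [CommRing S]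
    (f : R →+* S) (hf : f.IsIntegral) : ringKrullDim S ≤ ringKrullDim R := by
  algebraize [f]
  refine Order.krullDim_le_of_strictMono (PrimeSpectrum.comap f) fun p q hpq => ?_
  have hpq' : p.asIdeal < q.asIdeal := hpq
  obtain ⟨x, hxq, hxp⟩ := SetLike.exists_of_lt hpq'
  -- Incomparability: in an integral extension, strict inclusions of primes stay strict after
  -- contraction.
  have : Ideal.comap f p.asIdeal < Ideal.comap f q.asIdeal :=
    Ideal.comap_lt_comap_of_integral_mem_sdiff hpq'.le ⟨hxq, hxp⟩ (hf x)
  exact this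

/-- By Noether normalization `R` is integral over a polynomial ring in `s` variables, which then
embeds in the target; transcendence degree bounds `s`. -/
theorem ringKrullDim_le_of_injective_mvPolynomial {k R τ : Type*} [Field k] [CommRing R]
    [Algebra k R] [Algebra.FiniteType k R] [Fintype τ] (f : R →ₐ[k] MvPolynomial τ k)
    (hf : Function.Injective f) : ringKrullDim R ≤ (Fintype.card τ : ℕ) := by
  have : Nontrivial R := f.toRingHom.domain_nontrivial
  obtain ⟨s, g, hg, hint⟩ := exists_integral_inj_algHom_of_fg k R
  have h1 := ringKrullDim_le_of_isIntegral g.toRingHom hint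
  rw [MvPolynomial.ringKrullDim_of_isNoetherianRing, ringKrullDim_eq_zero_of_field,
    Nat.card_fin, zero_add] at h1
  refine h1.trans ?_
  have h2 := lift_trdeg_le_of_injective (f.comp g) (hf.comp hg)
  simp only [MvPolynomial.trdeg_of_isDomain, Cardinal.mk_fintype, Fintype.card_fin,
    Cardinal.lift_natCast] at h2
  have h3 : s ≤ Fintype.card τ := by exact_mod_cast h2
  exact_mod_cast h3

/-- A set is of dimension at most `card τ` if its Zariski closure is that of the image of a
polynomial map from affine `τ`-space. -/
theorem zariskiDim_le_card {σ τ k : Type*} [Field k] [Infinite k] [Finite σ] [Fintype τ]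
    {S : Set (σ → k)} (P : σ → MvPolynomial τ k)
    (hmem : ∀ x : τ → k, (fun s => MvPolynomial.eval x (P s)) ∈ S)
    (hdense : ∀ f : MvPolynomial σ k,
      (∀ x : τ → k, MvPolynomial.eval (fun s => MvPolynomial.eval x (P s)) f = 0) →
        ∀ y ∈ S, MvPolynomial.eval y f = 0) :
    zariskiDim S ≤ (Fintype.card τ : ℕ) := by
  have key : ∀ (x : τ → k) (f : MvPolynomial σ k),
      MvPolynomial.eval x (MvPolynomial.aeval P f) =
        MvPolynomial.eval (fun s => MvPolynomial.eval x (P s)) f := by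
    intro x f
    rw [MvPolynomial.aeval_def, ← MvPolynomial.coe_eval₂Hom, ← RingHom.comp_apply,
      MvPolynomial.comp_eval₂Hom]
    congr 2
    ext a
    simp
  -- Hence the coordinate ring embeds in the polynomial ring on `τ`. Over an infinite field a
  -- polynomial vanishing at every point is zero.
  have hker : MvPolynomial.vanishingIdeal k S = RingHom.ker (MvPolynomial.aeval (R := k) P) := by
    ext f
    rw [MvPolynomial.mem_vanishingIdeal_iff, RingHom.mem_ker]
    simp only [MvPolynomial.aeval_eq_eval]
    constructor
    · intro h
      refine MvPolynomial.funext fun x => ?_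
      rw [key, map_zero]
      exact h _ (hmem x)
    · intro h
      refine hdense f fun x => ?_
      rw [← key, h, map_zero]
  unfold zariskiDim
  rw [hker]
  exact ringKrullDim_le_of_injective_mvPolynomial _
    (Ideal.kerLiftAlg_injective (MvPolynomial.aeval (R := k) P))

/-! ### Invariance of both characteristic polynomials under block matrices. -/

/-- The coefficients, except the leading ones, of the characteristic polynomials of `A` and
of `A₁`. -/
noncomputable def charpolyCoeffs {n : ℕ} {R : Type*} [CommRing R] (A : Matrix (Fin (n + 1)) (Fin (n + 1)) R) :
    Fin (n + 1) ⊕ Fin n → R :=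
  Sum.elim (fun k => A.charpoly.coeff (k.rev : ℕ))
    (fun k => (deleteFirst A).charpoly.coeff (k.rev : ℕ))

theorem charpolyCoeffs_map {n : ℕ} {R S : Type*} [CommRing R] [CommRing S] (φ : R →+* S)
    (A : Matrix (Fin (n + 1)) (Fin (n + 1)) R) (s : Fin (n + 1) ⊕ Fin n) :
    charpolyCoeffs (A.map φ) s = φ (charpolyCoeffs A s) := by
  cases s with
  | inl k => simp [charpolyCoeffs, Matrix.charpoly_map]
  | inr k =>
    have : deleteFirst (A.map φ) = (deleteFirst A).map φ := rfl
    simp [charpolyCoeffs, this, Matrix.charpoly_map]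

/-- The rows and columns of the index `0` vanish outside the diagonal. -/
def IsBlock {n : ℕ} {R : Type*} [Zero R] (X : Matrix (Fin (n + 1)) (Fin (n + 1)) R) : Prop :=
  ∀ k : Fin n, X k.succ 0 = 0 ∧ X 0 k.succ = 0

section Block

variable {n : ℕ} {R : Type*} [CommRing R] {X Y A : Matrix (Fin (n + 1)) (Fin (n + 1)) R}

theorem deleteFirst_mul_of_isBlock_left (hX : IsBlock X) (A) :
    deleteFirst (X * A) = deleteFirst X * deleteFirst A := by
  ext k l
  simp [deleteFirst, Matrix.mul_apply, Fin.sum_univ_succ, (hX k).1]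

theorem deleteFirst_mul_of_isBlock_right (hX : IsBlock X) (A) :
    deleteFirst (A * X) = deleteFirst A * deleteFirst X := by
  ext k l
  simp [deleteFirst, Matrix.mul_apply, Fin.sum_univ_succ, (hX l).2]

theorem isBlock_one : IsBlock (1 : Matrix (Fin (n + 1)) (Fin (n + 1)) R) :=
  fun k => ⟨Matrix.one_apply_ne (Fin.succ_ne_zero k),
    Matrix.one_apply_ne (Fin.succ_ne_zero k).symm⟩

theorem isBlock_diagonal (d : Fin (n + 1) → R) : IsBlock (Matrix.diagonal d) :=
  fun k => ⟨Matrix.diagonal_apply_ne _ (Fin.succ_ne_zero k),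
    Matrix.diagonal_apply_ne _ (Fin.succ_ne_zero k).symm⟩

theorem isBlock_single {i j : Fin (n + 1)} (hi : i ≠ 0) (hj : j ≠ 0) (r : R) :
    IsBlock (Matrix.single i j r) :=
  fun _ => ⟨Matrix.single_apply_of_col_ne _ _ hj _, Matrix.single_apply_of_row_ne hi _ _ _⟩

theorem IsBlock.add (hX : IsBlock X) (hY : IsBlock Y) : IsBlock (X + Y) :=
  fun k => ⟨by simp [(hX k).1, (hY k).1], by simp [(hX k).2, (hY k).2]⟩

theorem IsBlock.smul (hX : IsBlock X) (r : R) : IsBlock (r • X) :=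
  fun k => ⟨by simp [(hX k).1], by simp [(hX k).2]⟩

/-- Deleting index `0` is multiplicative when one factor is block, so `charpoly_mul_comm` applies to
both matrices. `X` need not be invertible. -/
theorem charpolyCoeffs_mul_comm (hX : IsBlock X) (A) :
    charpolyCoeffs (X * A) = charpolyCoeffs (A * X) := by
  unfold charpolyCoeffs
  rw [Matrix.charpoly_mul_comm, deleteFirst_mul_of_isBlock_left hX,
    deleteFirst_mul_of_isBlock_right hX, Matrix.charpoly_mul_comm (deleteFirst X)]

theorem charpolyCoeffs_conj (hX : IsBlock X) (hYX : Y * X = 1) (A) :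
    charpolyCoeffs (X * A * Y) = charpolyCoeffs A := by
  rw [mul_assoc, charpolyCoeffs_mul_comm hX, mul_assoc, hYX, mul_one]

end Block

/-! ### The differential along commutators. -/

section Differential

variable {n : ℕ} {𝕜 : Type*} [RCLike 𝕜]

attribute [local instance] Matrix.normedAddCommGroup Matrix.normedSpace

theorem differentiable_charpoly_coeff {m : Type*} [Fintype m] [DecidableEq m] (k : ℕ) :
    Differentiable 𝕜 fun A : Matrix m m 𝕜 => A.charpoly.coeff k := by
  have h : (fun A : Matrix m m 𝕜 => A.charpoly.coeff k) =
      fun A => MvPolynomial.eval (fun e : m × m => A e.1 e.2)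
        ((Matrix.charpoly.univ 𝕜 m).coeff k) := by
    ext A
    exact (Matrix.charpoly.univ_coeff_eval₂Hom m (RingHom.id 𝕜) (fun e => A e.1 e.2) k).symm
  rw [h]
  have h1 : Differentiable 𝕜 fun x : m × m → 𝕜 =>
      MvPolynomial.eval x ((Matrix.charpoly.univ 𝕜 m).coeff k) := fun x =>
    (AnalyticOnNhd.eval_mvPolynomial _ x (Set.mem_univ x)).differentiableAt
  have h2 : Differentiable 𝕜 fun (A : Matrix m m 𝕜) (e : m × m) => A e.1 e.2 :=
    differentiable_pi.2 fun e =>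
      (Matrix.entryLinearMap 𝕜 𝕜 e.1 e.2).toContinuousLinearMap.differentiable
  exact h1.comp h2

theorem differentiable_charpolyCoeffs (s : Fin (n + 1) ⊕ Fin n) :
    Differentiable 𝕜 fun A : Matrix (Fin (n + 1)) (Fin (n + 1)) 𝕜 => charpolyCoeffs A s := by
  cases s with
  | inl k => exact differentiable_charpoly_coeff _
  | inr k =>
    let δ : Matrix (Fin (n + 1)) (Fin (n + 1)) 𝕜 →ₗ[𝕜] Matrix (Fin n) (Fin n) 𝕜 :=
      { toFun := deleteFirst, map_add' := fun _ _ => rfl, map_smul' := fun _ _ => rfl }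
    exact (differentiable_charpoly_coeff (k.rev : ℕ)).comp δ.toContinuousLinearMap.differentiable

theorem fderiv_charpolyCoeffs_commutatorMap {X : Matrix (Fin (n + 1)) (Fin (n + 1)) 𝕜}
    (hX : IsBlock X) (A : Matrix (Fin (n + 1)) (Fin (n + 1)) 𝕜) (s : Fin (n + 1) ⊕ Fin n) :
    fderiv 𝕜 (fun M : Matrix (Fin (n + 1)) (Fin (n + 1)) 𝕜 => charpolyCoeffs M s) A
      (commutatorMap A X) = 0 := by
  have hd := (differentiable_charpolyCoeffs (𝕜 := 𝕜) s) A
  have hline : ∀ v, HasDerivAt (fun t : 𝕜 => charpolyCoeffs (A + t • v) s)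
      (fderiv 𝕜 (fun M : Matrix (Fin (n + 1)) (Fin (n + 1)) 𝕜 => charpolyCoeffs M s) A v) 0 :=
    fun v => hd.hasFDerivAt.hasLineDerivAt v
  -- The two curves `(1 + tX)A` and `A(1 + tX)` have equal coefficients for every `t`; comparing
  -- derivatives at `0` gives the claim.
  have h : (fun t : 𝕜 => charpolyCoeffs (A + t • (X * A)) s) =
      fun t => charpolyCoeffs (A + t • (A * X)) s := by
    ext t
    have h1 : A + t • (X * A) = (1 + t • X) * A := by simp [add_mul]
    have h2 : A + t • (A * X) = A * (1 + t • X) := by simp [mul_add]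
    rw [h1, h2, charpolyCoeffs_mul_comm (isBlock_one.add (hX.smul t))]
  have h3 : commutatorMap A X = X * A - A * X := rfl
  rw [h3, map_sub, sub_eq_zero]
  exact (hline _).unique (h ▸ hline _)

theorem mem_preimageSpace_of_isBlock {G : Digraph (Fin (n + 1))} {A : paramSpace 𝕜 G}
    {X : Matrix (Fin (n + 1)) (Fin (n + 1)) 𝕜} (hX : IsBlock X)
    (hmem : commutatorMap A.1 X ∈ paramSpace 𝕜 G) : X ∈ preimageSpace G A := by
  refine ⟨⟨commutatorMap A.1 X, hmem⟩, ?_, rfl⟩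
  have h : HasFDerivAt (doubleCharpoly 𝕜 G) (ContinuousLinearMap.pi fun s =>
      (fderiv 𝕜 (fun M : Matrix (Fin (n + 1)) (Fin (n + 1)) 𝕜 => charpolyCoeffs M s) A.1).comp
        (paramSpace 𝕜 G).subtypeL) A := by
    refine hasFDerivAt_pi.2 fun s => ?_
    exact (differentiable_charpolyCoeffs (𝕜 := 𝕜) s A.1).hasFDerivAt.comp A
      (paramSpace 𝕜 G).subtypeL.hasFDerivAt
  have h' := h.fderiv
  change (fderiv 𝕜 (doubleCharpoly 𝕜 G) A) ⟨commutatorMap A.1 X, hmem⟩ = 0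
  erw [h']
  ext s
  exact fderiv_charpolyCoeffs_commutatorMap hX A.1 s

end Differential

/-! ### Commutators with `E_ij` and with diagonal matrices. -/

section Commutator

variable {V 𝕜 : Type*} [Field 𝕜]

theorem mem_paramSpace_iff {G : Digraph V} {A : Matrix V V 𝕜} :
    A ∈ paramSpace 𝕜 G ↔ ∀ k l, ¬ (k = l ∨ G.Adj l k) → A k l = 0 :=
  ⟨fun h k l hkl => h k l (fun h' => hkl (.inl h')) (fun h' => hkl (.inr h')),
    fun h k l h1 h2 => h k l (by tauto)⟩

theorem support_row_symbolicMatrix (G : Digraph V) (k : V) :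
    Function.support ((symbolicMatrix 𝕜 G).row k) = {l | k = l ∨ G.Adj l k} := by
  ext l
  simp [symbolicMatrix, Matrix.row, or_iff_not_imp_left]

theorem support_col_symbolicMatrix (G : Digraph V) (l : V) :
    Function.support ((symbolicMatrix 𝕜 G).col l) = {k | k = l ∨ G.Adj l k} := by
  ext k
  simp [symbolicMatrix, Matrix.col, or_iff_not_imp_left]

variable [Fintype V] [DecidableEq V]

theorem single_mul_apply (A : Matrix V V 𝕜) (i j k l : V) :
    (Matrix.single i j (1 : 𝕜) * A) k l = if k = i then A j l else 0 := by
  simp [Matrix.mul_apply, Matrix.single_apply, ite_and, eq_comm]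

theorem mul_single_apply (A : Matrix V V 𝕜) (i j k l : V) :
    (A * Matrix.single i j (1 : 𝕜)) k l = if l = j then A k i else 0 := by
  simp [Matrix.mul_apply, Matrix.single_apply, ite_and, eq_comm]

theorem commutatorMap_single_apply (A : Matrix V V 𝕜) (i j k l : V) :
    commutatorMap A (Matrix.single i j 1) k l =
      (if k = i then A j l else 0) - (if l = j then A k i else 0) := by
  rw [← single_mul_apply, ← mul_single_apply]
  rfl

theorem commutatorMap_diagonal_apply (A : Matrix V V 𝕜) (d : V → 𝕜) (k l : V) :
    commutatorMap A (Matrix.diagonal d) k l = (d k - d l) * A k l := by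
  have : commutatorMap A (Matrix.diagonal d) =
    Matrix.diagonal d * A - A * Matrix.diagonal d := rfl
  rw [this, Matrix.sub_apply, Matrix.diagonal_mul, Matrix.mul_diagonal]
  ring

theorem commutatorMap_diagonal_mem_paramSpace {G : Digraph V} {A : Matrix V V 𝕜}
    (hA : A ∈ paramSpace 𝕜 G) (d : V → 𝕜) :
    commutatorMap A (Matrix.diagonal d) ∈ paramSpace 𝕜 G :=
  fun k l h h' => by rw [commutatorMap_diagonal_apply, hA k l h h', mul_zero]

theorem commutatorMap_single_mem_paramSpace {G : Digraph V} {A : Matrix V V 𝕜} {i j : V}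
    (hsupp : SupportCondition (symbolicMatrix 𝕜 G) i j) (hA : A ∈ paramSpace 𝕜 G) :
    commutatorMap A (Matrix.single i j 1) ∈ paramSpace 𝕜 G := by
  rw [mem_paramSpace_iff] at hA ⊢
  obtain ⟨hrow, hcol⟩ := hsupp
  rw [support_row_symbolicMatrix, support_row_symbolicMatrix] at hrow
  rw [support_col_symbolicMatrix, support_col_symbolicMatrix] at hcol
  intro k l hkl
  rw [commutatorMap_single_apply]
  have h1 : (if k = i then A j l else 0) = 0 := by
    split_ifs with h
    · subst h
      exact hA j l fun h => hkl (hrow h)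
    · rfl
  have h2 : (if l = j then A k i else 0) = 0 := by
    split_ifs with h
    · subst h
      exact hA k i fun h => hkl (hcol h)
    · rfl
  rw [h1, h2, sub_zero]

/-- Along a path from `i` to `j` that neither returns to `i` nor leaves `j`, the diagonal part of
a decomposition of `E_ij` has to be constant. -/
theorem single_notMem_trivialSpace {G : Digraph V} (hconn : StronglyConnected G) {i j : V}
    (hij : i ≠ j) {A : Matrix V V 𝕜} (hdiag : A i i ≠ A j j)
    (hedge : ∀ k l, G.Adj l k → A k l ≠ 0) :
    Matrix.single i j (1 : 𝕜) ∉ trivialSpace A := by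
  intro hmem
  obtain ⟨Z, hZ, D, ⟨d, rfl⟩, hsum⟩ := Submodule.mem_sup.1 hmem
  change Z + Matrix.diagonal d = Matrix.single i j 1 at hsum
  have hZ' : commutatorMap A Z = 0 := hZ
  have h : ∀ k l, (d k - d l) * A k l =
      (if k = i then A j l else 0) - (if l = j then A k i else 0) := by
    intro k l
    rw [← commutatorMap_single_apply, ← commutatorMap_diagonal_apply, ← hsum, map_add, hZ',
      zero_add]
  -- The first alternative absorbs paths that have passed through `j`, since column `j` of the
  -- commutator need not vanish. An edge back into `i` is harmless.
  have hconst : ∀ v, Relation.ReflTransGen G.Adj i v → d i = d j ∨ d v = d i := by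
    intro v hv
    induction hv with
    | refl => exact .inr rfl
    | @tail u w _ huw ih =>
      rcases ih with ih | ih
      · exact .inl ih
      by_cases hu : u = j
      · subst hu; exact .inl ih.symm
      by_cases hw : w = i
      · subst hw; exact .inr rfl
      have := h w u
      rw [if_neg hw, if_neg hu, sub_zero, mul_eq_zero, or_iff_left (hedge w u huw),
        sub_eq_zero] at this
      exact .inr (this.trans ih)
  have hd : d i = d j := (hconst j (hconn i j)).elim id Eq.symm
  have := h i j
  rw [hd, sub_self, zero_mul, if_pos rfl, if_pos rfl] at this
  exact hdiag (sub_eq_zero.1 this.symm).symm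

end Commutator

/-! ### Membership in `V_A` and genericity. -/

section General

variable {n : ℕ} {𝕜 : Type*} [RCLike 𝕜] {G : Digraph (Fin (n + 1))}

theorem trivialSpace_le_preimageSpace (A : paramSpace 𝕜 G) :
    trivialSpace A.1 ≤ preimageSpace G A := by
  refine sup_le (fun X hX => ?_) ?_
  · have hX' : commutatorMap A.1 X = 0 := hX
    refine ⟨0, zero_mem _, ?_⟩
    rw [hX', map_zero]
  · rintro _ ⟨d, rfl⟩
    exact mem_preimageSpace_of_isBlock (isBlock_diagonal d)
      (commutatorMap_diagonal_mem_paramSpace A.2 d)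

theorem single_mem_preimageSpace {i j : Fin (n + 1)} (hi : i ≠ 0) (hj : j ≠ 0)
    (hsupp : SupportCondition (symbolicMatrix 𝕜 G) i j) (A : paramSpace 𝕜 G) :
    Matrix.single i j (1 : 𝕜) ∈ preimageSpace G A :=
  mem_preimageSpace_of_isBlock (isBlock_single hi hj 1)
    (commutatorMap_single_mem_paramSpace hsupp A.2)

open Classical in
theorem forGeneral_diag_ne_and_edge_ne_zero {i j : Fin (n + 1)} (hij : i ≠ j) :
    ForGeneral G fun A : paramSpace 𝕜 G =>
      A.1 i i ≠ A.1 j j ∧ ∀ k l, G.Adj l k → A.1 k l ≠ 0 := by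
  refine ⟨(MvPolynomial.X (i, i) - MvPolynomial.X (j, j)) *
    ∏ e : Fin (n + 1) × Fin (n + 1) with G.Adj e.2 e.1, MvPolynomial.X e, ?_, ?_⟩
  -- The entry `2` at `(i, i)` separates it from the entry `1` at `(j, j)`.
  · refine ⟨⟨Matrix.of fun k l => if k = i ∧ l = i then 2 else if k = l ∨ G.Adj l k then 1 else 0,
      mem_paramSpace_iff.2 fun k l h => ?_⟩, ?_⟩
    · rw [Matrix.of_apply, if_neg fun h' => h (.inl (h'.1.trans h'.2.symm)), if_neg h]
    · simp only [map_mul, map_sub, map_prod, MvPolynomial.eval_X, Matrix.of_apply]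
      refine mul_ne_zero (by norm_num [hij.symm]) (Finset.prod_ne_zero_iff.2 fun e he => ?_)
      rw [if_pos (Or.inr (Finset.mem_filter.1 he).2)]
      split_ifs
      · exact two_ne_zero
      · exact one_ne_zero
  · intro A hA
    simp only [map_mul, map_sub, map_prod, MvPolynomial.eval_X] at hA
    refine ⟨sub_ne_zero.1 (left_ne_zero_of_mul hA), fun k l hkl => ?_⟩
    exact Finset.prod_ne_zero_iff.1 (right_ne_zero_of_mul hA) (k, l) (by simpa using hkl)

end General

/-! ### Normal forms and the bound on the dimension. -/

section Slice

/-- A set of positions spans a coordinate subspace, and a continuous function on it vanishes if it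
vanishes at all matrices with full support. -/
theorem eq_zero_of_forall_ne_zero {V 𝕜 : Type*} [Finite V] [RCLike 𝕜] {φ : Matrix V V 𝕜 → 𝕜}
    (hφ : Continuous φ) (S : Set (V × V))
    (h : ∀ A : Matrix V V 𝕜, (∀ k l, (k, l) ∈ S → A k l ≠ 0) →
      (∀ k l, (k, l) ∉ S → A k l = 0) → φ A = 0)
    (A : Matrix V V 𝕜) (hA : ∀ k l, (k, l) ∉ S → A k l = 0) : φ A = 0 := by
  classical
  let B : Matrix V V 𝕜 := Matrix.of fun k l => if (k, l) ∈ S then 1 else 0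
  have hB : ∀ k l, B k l = if (k, l) ∈ S then 1 else 0 := fun _ _ => rfl
  have hT : (Set.range fun e : V × V => -A e.1 e.2).Finite := Set.finite_range _
  -- On the line `A + s B`, all entries in `S` are nonzero except for finitely many `s`, so density
  -- gives the value at `s = 0`.
  have hc : Continuous fun s : 𝕜 => φ (A + s • B) := hφ.comp (by fun_prop)
  have heq := hc.ext_on (hT.countable.dense_compl 𝕜) continuous_zero fun s hs => by
    refine h _ (fun k l hkl h0 => hs ⟨(k, l), ?_⟩) fun k l hkl => ?_
    · rw [Matrix.add_apply, Matrix.smul_apply, hB, if_pos hkl, smul_eq_mul, mul_one] at h0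
      exact (eq_neg_of_add_eq_zero_right h0).symm
    · rw [Matrix.add_apply, Matrix.smul_apply, hB, if_neg hkl, smul_zero, add_zero, hA k l hkl]
  simpa using congrFun heq 0

attribute [local instance] Matrix.normedAddCommGroup Matrix.normedSpace in
theorem continuous_eval_charpolyCoeffs {n : ℕ} {𝕜 : Type*} [RCLike 𝕜]
    (f : MvPolynomial (Fin (n + 1) ⊕ Fin n) 𝕜) :
    Continuous fun A : Matrix (Fin (n + 1)) (Fin (n + 1)) 𝕜 =>
      MvPolynomial.eval (charpolyCoeffs A) f :=
  (MvPolynomial.continuous_eval f).comp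
    (continuous_pi fun s => (differentiable_charpolyCoeffs (𝕜 := 𝕜) s).continuous)

/-- A spanning out-tree: every vertex `v` other than the root `j` has a parent `p v`, which is
closer to the root, and the out-neighbours of the root are its children. -/
theorem exists_spanning_tree {V : Type*} {G : Digraph V} (hloop : ∀ v, ¬ G.Adj v v)
    (hconn : StronglyConnected G) (j : V) :
    ∃ (p : V → V) (ρ : V → ℕ), (∀ v, v ≠ j → G.Adj (p v) v ∧ ρ v = ρ (p v) + 1) ∧
      ∀ v, G.Adj j v → p v = j := by
  classical
  obtain ⟨reach, hzero, hsucc⟩ : ∃ reach : ℕ → V → Prop, (∀ v, reach 0 v ↔ v = j) ∧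
      ∀ k v, reach (k + 1) v ↔ ∃ u, reach k u ∧ G.Adj u v :=
    -- `reach k v` means that a walk of length `k` leads from `j` to `v`; `ρ` below is the distance
    -- from `j`.
    ⟨fun k => Nat.rec (fun v => v = j) (fun _ R v => ∃ u, R u ∧ G.Adj u v) k,
      fun _ => Iff.rfl, fun _ _ => Iff.rfl⟩
  have hreach : ∀ v, ∃ k, reach k v := by
    intro v
    induction hconn j v with
    | refl => exact ⟨0, (hzero j).2 rfl⟩
    | tail _ huw ih => exact ih.elim fun k hk => ⟨k + 1, (hsucc _ _).2 ⟨_, hk, huw⟩⟩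
  let ρ : V → ℕ := fun v => Nat.find (hreach v)
  have hρ : ∀ v, v ≠ j → ∃ u, G.Adj u v ∧ ρ v = ρ u + 1 := by
    intro v hv
    have hspec : reach (ρ v) v := Nat.find_spec (hreach v)
    obtain ⟨k, hk⟩ : ∃ k, ρ v = k + 1 := Nat.exists_eq_succ_of_ne_zero fun h0 => by
      rw [h0, hzero] at hspec
      exact hv hspec
    rw [hk, hsucc] at hspec
    obtain ⟨u, hu, huv⟩ := hspec
    refine ⟨u, huv, le_antisymm ?_ ?_⟩
    · exact Nat.find_min' (hreach v) ((hsucc _ _).2 ⟨u, Nat.find_spec (hreach u), huv⟩)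
    · rw [hk]
      exact Nat.succ_le_succ (Nat.find_min' (hreach u) hu)
  have hρj : ∀ v, ρ v = 0 → v = j := by
    intro v hv
    have hspec : reach (ρ v) v := Nat.find_spec (hreach v)
    rwa [hv, hzero] at hspec
  have hp : ∀ v, ∃ u, v ≠ j → G.Adj u v ∧ ρ v = ρ u + 1 := fun v => by
    by_cases hv : v = j
    · exact ⟨v, fun h => absurd hv h⟩
    · exact (hρ v hv).imp fun u hu _ => hu
  choose p hp using hp
  refine ⟨p, ρ, hp, fun v hv => hρj _ ?_⟩
  have hvj : v ≠ j := by
    rintro rfl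
    exact hloop _ hv
  have h1 : ρ v ≤ 1 := Nat.find_min' (hreach v) ((hsucc 0 v).2 ⟨j, (hzero j).2 rfl, hv⟩)
  have := (hp v hvj).2
  omega

/-- Nonzero weights on the edges of a tree are a coboundary. -/
theorem exists_potential {V 𝕜 : Type*} [Field 𝕜] {p : V → V} {ρ : V → ℕ} {j : V}
    (hp : ∀ v, v ≠ j → ρ v = ρ (p v) + 1) (a : V → 𝕜) (ha : ∀ v, v ≠ j → a v ≠ 0) :
    ∃ d : V → 𝕜, (∀ v, d v ≠ 0) ∧ ∀ v, v ≠ j → d v * a v = d (p v) := by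
  classical
  -- Nothing is known about `a j`; the value `1` keeps every factor invertible. The potential at `v`
  -- is the product of the inverse weights met on iterating `p` from `v`.
  let b : V → 𝕜 := fun v => if v = j then 1 else a v
  have hb : ∀ v, b v ≠ 0 := fun v => by
    by_cases hv : v = j
    · simp [b, hv]
    · simpa [b, hv] using ha v hv
  refine ⟨fun v => ∏ k ∈ Finset.range (ρ v), (b (p^[k] v))⁻¹,
    fun v => Finset.prod_ne_zero_iff.2 fun k _ => inv_ne_zero (hb _), fun v hv => ?_⟩
  have hbv : a v = b v := by simp [b, hv]
  simp only [hp v hv, Finset.prod_range_succ', Function.iterate_succ_apply,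
    Function.iterate_zero_apply]
  rw [hbv, mul_assoc, inv_mul_cancel₀ (hb v), mul_one]

theorem ncard_support {V : Type*} [Finite V] {G : Digraph V} (hloop : ∀ v, ¬ G.Adj v v) :
    {e : V × V | e.1 = e.2 ∨ G.Adj e.2 e.1}.ncard = numEdges G + Nat.card V := by
  have h1 : {e : V × V | e.1 = e.2 ∨ G.Adj e.2 e.1} =
      Prod.swap '' {e : V × V | G.Adj e.1 e.2} ∪ Set.range fun v : V => (v, v) := by
    ext ⟨k, l⟩
    simp [or_comm, eq_comm]
  have h2 : Disjoint (Prod.swap '' {e : V × V | G.Adj e.1 e.2}) (Set.range fun v : V => (v, v)) := by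
    rw [Set.disjoint_right]
    rintro _ ⟨v, rfl⟩
    simpa using hloop v
  rw [h1, Set.ncard_union_eq h2, Set.ncard_image_of_injective _ Prod.swap_injective,
    ← Set.image_univ, Set.ncard_image_of_injective _ fun v w h => congrArg Prod.fst h,
    Set.ncard_univ]
  rfl

theorem ncard_tree {V : Type*} [Finite V] (p : V → V) (j : V) :
    {e : V × V | e.1 ≠ j ∧ e.2 = p e.1}.ncard + 1 = Nat.card V := by
  have h1 : {e : V × V | e.1 ≠ j ∧ e.2 = p e.1} = (fun v => (v, p v)) '' {j}ᶜ := by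
    ext ⟨k, l⟩
    simp only [Set.mem_ofPred_eq, Set.mem_image, Set.mem_compl_iff, Set.mem_singleton_iff,
      Prod.mk.injEq]
    constructor
    · rintro ⟨h, rfl⟩
      exact ⟨k, h, rfl, rfl⟩
    · rintro ⟨v, h, rfl, rfl⟩
      exact ⟨h, rfl⟩
  rw [h1, Set.ncard_image_of_injective _ fun v w h => congrArg Prod.fst h]
  have := Set.ncard_add_ncard_compl ({j} : Set V)
  rw [Set.ncard_singleton] at this
  omega

open Classical in
/-- The matrix with indeterminates at the positions in `T`, ones at the remaining positions in
`U`, and zeros elsewhere. -/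
noncomputable def normalForm {V : Type*} (𝕜 : Type*) [Field 𝕜] (T U : Set (V × V)) :
    Matrix V V (MvPolynomial T 𝕜) :=
  Matrix.of fun k l =>
    if h : (k, l) ∈ T then MvPolynomial.X ⟨(k, l), h⟩ else if (k, l) ∈ U then 1 else 0

theorem normalForm_map_eval {V 𝕜 : Type*} [Field 𝕜] {T U : Set (V × V)} (A : Matrix V V 𝕜)
    (hU : ∀ k l, (k, l) ∈ U → A k l = 1) (h0 : ∀ k l, (k, l) ∉ T → (k, l) ∉ U → A k l = 0) :
    (normalForm 𝕜 T U).map (MvPolynomial.eval fun e : T => A e.1.1 e.1.2) = A := by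
  ext k l
  rw [normalForm, Matrix.map_apply, Matrix.of_apply]
  split_ifs with h1 h2
  · rw [MvPolynomial.eval_X]
  · rw [map_one, hU k l h2]
  · rw [map_zero, h0 k l h1 h2]

theorem normalForm_map_eval_mem_paramSpace {V 𝕜 : Type*} [Field 𝕜] {G : Digraph V}
    {T U : Set (V × V)} (hT : ∀ e ∈ T, e.1 = e.2 ∨ G.Adj e.2 e.1)
    (hU : ∀ e ∈ U, e.1 = e.2 ∨ G.Adj e.2 e.1) (x : T → 𝕜) :
    (normalForm 𝕜 T U).map (MvPolynomial.eval x) ∈ paramSpace 𝕜 G := by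
  refine mem_paramSpace_iff.2 fun k l hkl => ?_
  rw [normalForm, Matrix.map_apply, Matrix.of_apply, dif_neg fun h => hkl (hT _ h),
    if_neg fun h => hkl (hU _ h), map_zero]

variable {n : ℕ} {𝕜 : Type*} [RCLike 𝕜] {G : Digraph (Fin (n + 1))}

theorem eval_charpolyCoeffs_eq_zero {T U : Set (Fin (n + 1) × Fin (n + 1))}
    {f : MvPolynomial (Fin (n + 1) ⊕ Fin n) 𝕜}
    (hf : ∀ x : T → 𝕜, MvPolynomial.eval
      (fun s => MvPolynomial.eval x (charpolyCoeffs (normalForm 𝕜 T U) s)) f = 0)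
    {A : Matrix (Fin (n + 1)) (Fin (n + 1)) 𝕜} (hU : ∀ k l, (k, l) ∈ U → A k l = 1)
    (h0 : ∀ k l, (k, l) ∉ T → (k, l) ∉ U → A k l = 0) :
    MvPolynomial.eval (charpolyCoeffs A) f = 0 := by
  have hx := hf fun e => A e.1.1 e.1.2
  simp only [← charpolyCoeffs_map] at hx
  rwa [normalForm_map_eval A hU h0] at hx

/-- Conjugation by `1 + t E_ij` moves a matrix of `Θ_G` into the hyperplane of matrices whose
entry at `(i, l)` is zero, if `(j, l)` carries a nonzero entry. -/
theorem exists_charpolyCoeffs_eq_of_supportCondition {i j l : Fin (n + 1)} (hi : i ≠ 0)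
    (hj : j ≠ 0) (hij : i ≠ j) (hlj : l ≠ j)
    (hsupp : SupportCondition (symbolicMatrix 𝕜 G) i j)
    {A : Matrix (Fin (n + 1)) (Fin (n + 1)) 𝕜} (hA : A ∈ paramSpace 𝕜 G) (hjl : A j l ≠ 0) :
    ∃ B ∈ paramSpace 𝕜 G, B i l = 0 ∧ charpolyCoeffs B = charpolyCoeffs A := by
  -- For `l ≠ j` the conjugate has entry `A i l + t * A j l` at `(i, l)`; this `t` makes it zero.
  set t : 𝕜 := -(A i l / A j l) with ht
  set E : Matrix (Fin (n + 1)) (Fin (n + 1)) 𝕜 := Matrix.single i j 1 with hE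
  have hEE : E * E = 0 := Matrix.single_mul_single_of_ne _ _ _ _ hij.symm _
  have hinv : (1 - t • E) * (1 + t • E) = 1 := by
    simp [sub_mul, mul_add, hEE]
  have hB : (1 + t • E) * A * (1 - t • E) =
      A + t • commutatorMap A E - (t * t * A j i) • E := by
    have h1 : E * A * E = A j i • E := by
      rw [hE, Matrix.single_mul_mul_single, Matrix.smul_single]
      simp
    have h2 : commutatorMap A E = E * A - A * E := rfl
    rw [h2, mul_smul (t * t), ← h1]
    simp only [add_mul, mul_sub, one_mul, mul_one, smul_mul_assoc, mul_smul_comm, smul_sub,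
      smul_add, mul_smul]
    abel
  -- Row containment at the diagonal position `(j, j)` puts `(i, j)` in the support, so the
  -- quadratic term in `t` also stays in `Θ_G`.
  have hijG : i = j ∨ G.Adj j i := by
    have := hsupp.1
    rw [support_row_symbolicMatrix, support_row_symbolicMatrix] at this
    exact this (.inl rfl)
  have hEmem : E ∈ paramSpace 𝕜 G := mem_paramSpace_iff.2 fun k l hkl =>
    Matrix.single_apply_of_ne _ _ _ _ _ (by rintro ⟨rfl, rfl⟩; exact hkl hijG)
  refine ⟨(1 + t • E) * A * (1 - t • E), ?_, ?_, ?_⟩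
  · rw [hB]
    exact sub_mem (add_mem hA (Submodule.smul_mem _ _
      (commutatorMap_single_mem_paramSpace hsupp hA))) (Submodule.smul_mem _ _ hEmem)
  · rw [hB, Matrix.sub_apply, Matrix.add_apply, Matrix.smul_apply, Matrix.smul_apply,
      commutatorMap_single_apply, if_pos rfl, if_neg hlj, hE,
      Matrix.single_apply_of_col_ne _ _ hlj.symm, ht]
    simp only [smul_eq_mul]
    field_simp
    ring
  · exact charpolyCoeffs_conj (isBlock_one.add ((isBlock_single hi hj 1).smul t)) hinv A

/-- Conjugation by a diagonal matrix normalizes the entries at the edges of a tree to one. -/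
theorem exists_charpolyCoeffs_eq_of_tree {p : Fin (n + 1) → Fin (n + 1)} {ρ : Fin (n + 1) → ℕ}
    {j : Fin (n + 1)} (hp : ∀ v, v ≠ j → ρ v = ρ (p v) + 1)
    {A : Matrix (Fin (n + 1)) (Fin (n + 1)) 𝕜} (hA : ∀ v, v ≠ j → A v (p v) ≠ 0) :
    ∃ B : Matrix (Fin (n + 1)) (Fin (n + 1)) 𝕜, (∀ v, v ≠ j → B v (p v) = 1) ∧
      (∀ k l, A k l = 0 → B k l = 0) ∧ charpolyCoeffs B = charpolyCoeffs A := by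
  obtain ⟨d, hd, hdp⟩ := exists_potential hp (fun v => A v (p v)) hA
  have happly : ∀ k l, (Matrix.diagonal d * A * Matrix.diagonal d⁻¹) k l =
      d k * A k l * (d l)⁻¹ := fun k l => by
    rw [Matrix.mul_diagonal, Matrix.diagonal_mul, Pi.inv_apply]
  refine ⟨Matrix.diagonal d * A * Matrix.diagonal d⁻¹, fun v hv => ?_, fun k l hkl => ?_,
    charpolyCoeffs_conj (isBlock_diagonal d) ?_ A⟩
  · rw [happly, hdp v hv, mul_inv_cancel₀ (hd _)]
  · rw [happly, hkl, mul_zero, zero_mul]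
  · rw [Matrix.diagonal_mul_diagonal, ← Matrix.diagonal_one]
    congr 1
    ext v
    exact inv_mul_cancel₀ (hd v)

theorem zariskiDim_range_doubleCharpoly_le (hloop : ∀ v, ¬ G.Adj v v)
    (hconn : StronglyConnected G) {i j : Fin (n + 1)} (hi : i ≠ 0) (hj : j ≠ 0) (hij : i ≠ j)
    (hsupp : SupportCondition (symbolicMatrix 𝕜 G) i j) :
    zariskiDim (Set.range (doubleCharpoly 𝕜 G)) ≤ (numEdges G : ℕ) := by
  classical
  have hrow : {l | j = l ∨ G.Adj l j} ⊆ {l | i = l ∨ G.Adj l i} := by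
    have := hsupp.1
    rwa [support_row_symbolicMatrix, support_row_symbolicMatrix] at this
  have hji : G.Adj j i := (hrow (.inl rfl)).resolve_left hij
  obtain ⟨l, -, hlj⟩ := ((hconn i j).cases_tail).resolve_left hij.symm
  have hl : l ≠ j := by
    rintro rfl
    exact hloop _ hlj
  obtain ⟨p, ρ, hp, hpj⟩ := exists_spanning_tree hloop hconn j
  let supp : Set (Fin (n + 1) × Fin (n + 1)) := {e | e.1 = e.2 ∨ G.Adj e.2 e.1}
  let S := supp \ {(i, l)}
  let U : Set (Fin (n + 1) × Fin (n + 1)) := {e | e.1 ≠ j ∧ e.2 = p e.1}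
  -- The cleared position `(i, l)` is not a tree position: `j → i` is an edge, so the parent of `i`
  -- is `j ≠ l`.
  have hUS : U ⊆ S := by
    rintro ⟨v, w⟩ ⟨hv, hw⟩
    obtain rfl : w = p v := hw
    refine ⟨.inr (hp v hv).1, fun h => ?_⟩
    obtain ⟨rfl, h'⟩ := Prod.mk.inj (Set.mem_singleton_iff.1 h)
    exact hl (h'.symm.trans (hpj _ hji))
  let T := S \ U
  -- `m + (n + 1)` support positions, minus the cleared one, minus `n` tree positions.
  have hcard : Fintype.card T = numEdges G := by
    have h1 := ncard_support hloop
    have h2 := ncard_tree p j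
    have h3 : T.ncard + U.ncard = S.ncard := Set.ncard_sdiff_add_ncard_of_subset hUS
    have h4 : S.ncard + 1 = supp.ncard :=
      Set.ncard_sdiff_singleton_add_one (show (i, l) ∈ supp from hrow (.inr hlj))
    rw [← Nat.card_eq_fintype_card, Nat.card_coe_set_eq]
    change supp.ncard = _ at h1
    change U.ncard + 1 = _ at h2
    omega
  rw [← hcard]
  refine zariskiDim_le_card (fun s => charpolyCoeffs (normalForm 𝕜 T U) s) (fun x => ?_) ?_
  · refine ⟨⟨_, normalForm_map_eval_mem_paramSpace (fun e he => he.1.1)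
      (fun e he => (hUS he).1) x⟩, ?_⟩
    ext s
    exact charpolyCoeffs_map (MvPolynomial.eval x) _ s
  rintro f hf _ ⟨A, rfl⟩
  have hcont := continuous_eval_charpolyCoeffs f
  -- Vanishing of `f` spreads from normal forms to the slice by diagonal conjugation, then from the
  -- slice to `Θ_G` by `1 + t E_ij`. Each time nonzero entries are needed, and continuity removes
  -- that restriction.
  have hslice : ∀ A : Matrix (Fin (n + 1)) (Fin (n + 1)) 𝕜, (∀ k l, (k, l) ∉ S → A k l = 0) →
      MvPolynomial.eval (charpolyCoeffs A) f = 0 := by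
    refine eq_zero_of_forall_ne_zero hcont S fun A hne h0 => ?_
    obtain ⟨B, hB1, hB0, hBA⟩ := exists_charpolyCoeffs_eq_of_tree (fun v hv => (hp v hv).2)
      fun v hv => hne v (p v) (hUS ⟨hv, rfl⟩)
    rw [← hBA]
    refine eval_charpolyCoeffs_eq_zero hf (fun k l' hkl => ?_) fun k l' hT hU =>
      hB0 k l' (h0 k l' fun hS => hT ⟨hS, hU⟩)
    obtain ⟨hk, hl'⟩ := hkl
    obtain rfl : l' = p k := hl'
    exact hB1 k hk
  refine eq_zero_of_forall_ne_zero hcont supp (fun A hne h0 => ?_) A.1 (mem_paramSpace_iff.1 A.2)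
  obtain ⟨B, hB, hBil, hBA⟩ := exists_charpolyCoeffs_eq_of_supportCondition hi hj hij hl hsupp
    (mem_paramSpace_iff.2 h0) (hne j l (.inr hlj))
  rw [← hBA]
  refine hslice B fun k l' hkl => ?_
  by_cases h : (k, l') ∈ supp
  · obtain ⟨rfl, rfl⟩ : k = i ∧ l' = l := by
      by_contra h'
      exact hkl ⟨h, fun h'' => h' (Prod.mk.inj h'')⟩
    exact hBil
  · exact mem_paramSpace_iff.1 hB k l' h

end Slice

end Compartment

theorem lemma3p11 {𝕜 : Type*} [RCLike 𝕜] (n : ℕ) (G : Digraph (Fin (n + 1)))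
    (hloop : ∀ v, ¬ G.Adj v v) (hconn : Compartment.StronglyConnected G)
    (i j : Fin (n + 1)) (hi : i ≠ 0) (hj : j ≠ 0) (hij : i ≠ j)
    (hsupp : Compartment.SupportCondition (Compartment.symbolicMatrix 𝕜 G) i j) :
    (∀ A : Compartment.paramSpace 𝕜 G,
      Compartment.trivialSpace A.1 ≤ Compartment.preimageSpace G A ∧
      Matrix.single i j (1 : 𝕜) ∈ Compartment.preimageSpace G A) ∧
    Compartment.ForGeneral G (fun A : Compartment.paramSpace 𝕜 G =>
      ∃ hX : Matrix.single i j (1 : 𝕜) ∈ Compartment.preimageSpace G A,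
        (Submodule.Quotient.mk ⟨Matrix.single i j (1 : 𝕜), hX⟩ :
          Compartment.preimageSpace G A ⧸
            (Compartment.trivialSpace A.1).submoduleOf (Compartment.preimageSpace G A)) ≠ 0) ∧
    ¬ Compartment.HasExpectedDimension 𝕜 G := by
  refine ⟨fun A => ⟨Compartment.trivialSpace_le_preimageSpace A,
    Compartment.single_mem_preimageSpace hi hj hsupp A⟩, ?_, fun h => ?_⟩
  · obtain ⟨q, hq, hgen⟩ := Compartment.forGeneral_diag_ne_and_edge_ne_zero (𝕜 := 𝕜) (G := G) hij
    refine ⟨q, hq, fun A hA => ⟨Compartment.single_mem_preimageSpace hi hj hsupp A, fun h => ?_⟩⟩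
    obtain ⟨hdiag, hedge⟩ := hgen A hA
    refine Compartment.single_notMem_trivialSpace hconn hij hdiag hedge ?_
    rw [Submodule.Quotient.mk_eq_zero] at h
    exact h
  · have hle := Compartment.zariskiDim_range_doubleCharpoly_le hloop hconn hi hj hij hsupp
    have heq : Compartment.zariskiDim (Set.range (Compartment.doubleCharpoly 𝕜 G)) = _ := h
    rw [heq] at hle
    have : Compartment.numEdges G + 1 ≤ Compartment.numEdges G := by exact_mod_cast hle
    omega
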